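/- **Definitions.** An *anti-lecture hall composition* is an infinite sequence $\lambda=(\lambda_1,\lambda_2,\ldots)$ of nonnegative integers, with only finitely many nonzero entries, such that $$\frac{\lambda_1}{1}\ge\frac{\lambda_2}{2}\ge\frac{\lambda_3}{3}\ge\cdots ;$$ its weight is $|\lambda|=\lambda_1+\lambda_2+\cdots$. Let $A$ be the set of all anti-lecture hall compositions, and let $F_m(n)$ be the set of those with $|\lambda|=n$ and $\lambda_1\le m$. An *overpartition* of $n$ is a partition of $n$ into positive integers in which the first occurrence of each part size may be overlined. Let $H_k(n)$ be the set of overpartitions of $n$ none of whose non-overlined parts is congruent to $0$, $1$ or $-1$ modulo $k$. Write $(a;b)_\infty=\prod_{i\ge 0}(1-ab^i)$. **Theorem.** Let $k\ge 3$ be an integer. Then, as formal power series in $q$, $$\sum_{\lambda\in A,\ \lambda_1\le k-2} q^{|\lambda|}=\frac{(-q;q)_\infty}{(q;q)_\infty}\,(q;q^k)_\infty\,(q^{k-1};q^k)_\infty\,(q^k;q^k)_\infty .$$ Equivalently, for every positive integer $n$, the sets $F_{k-2}(n)$ and $H_k(n)$ are finite and $|F_{k-2}(n)|=|H_k(n)|$.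 -/

import Mathlib

open scoped PowerSeries PowerSeries.WithPiTopology

/-- An anti-lecture hall composition, as an infinite vector ending with zeros: a finitely supported
sequence of nonnegative integers with `λ₁/1 ≥ λ₂/2 ≥ λ₃/3 ≥ ⋯ (≥ 0)`.
The value `l i` is the entry `λ_{i+1}`, so that `l 0` is the first entry `λ₁`. -/
def IsAntiLectureHall (l : ℕ →₀ ℕ) : Prop :=
  ∀ i : ℕ, (l (i + 1) : ℚ) / ((i : ℚ) + 2) ≤ (l i : ℚ) / ((i : ℚ) + 1)

/-- The weight `|λ| = λ₁ + λ₂ + ⋯`. -/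
def weight (l : ℕ →₀ ℕ) : ℕ := l.sum fun _ x => x

/-- The set `F_m(n)` of anti-lecture hall compositions `λ` of `n` with `λ₁ ≤ m`. -/
def antiLectureHallBounded (m n : ℕ) : Set (ℕ →₀ ℕ) :=
  {l | IsAntiLectureHall l ∧ weight l = n ∧ l 0 ≤ m}

/-- An overpartition of `n`: a partition of `n` (a multiset of positive integers with sum `n`) in
which the first occurrence of each part size may be overlined. It is recorded by the underlying
partition and the set of those part sizes whose first occurrence is overlined. -/
structure Overpartition (n : ℕ) where
  partition : n.Partition
  overlined : Finset ℕ
  overlined_subset : overlined ⊆ partition.parts.toFinset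

/-- The multiset of non-overlined parts: one occurrence of each overlined part size is removed
from the parts. -/
def Overpartition.nonOverlined {n : ℕ} (π : Overpartition n) : Multiset ℕ :=
  π.partition.parts - π.overlined.val

/-- The set `H_k(n)` of overpartitions of `n` all of whose non-overlined parts are not congruent to
`0`, `1`, `-1` modulo `k`. -/
def overpartitionsAvoiding (k n : ℕ) : Set (Overpartition n) :=
  {π | ∀ p ∈ π.nonOverlined,
    ¬ (p : ℤ) ≡ 0 [ZMOD k] ∧ ¬ (p : ℤ) ≡ 1 [ZMOD k] ∧ ¬ (p : ℤ) ≡ -1 [ZMOD k]}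

/-- `(a; b)_∞ = ∏_{i ≥ 0} (1 - a bⁱ)`, as a formal power series with integer coefficients
(the limit is the coefficientwise one). -/
noncomputable def qPochInf (a b : ℤ⟦X⟧) : ℤ⟦X⟧ := ∏' i : ℕ, (1 - a * b ^ i)

/-- The product defining `(a; b)_∞` converges whenever `b` has constant term zero. -/
theorem qPochInf_multipliable (a b : ℤ⟦X⟧) (hb : PowerSeries.constantCoeff b = 0) :
    Multipliable fun i : ℕ => (1 - a * b ^ i) := by
  simp_rw [sub_eq_add_neg]
  apply PowerSeries.WithPiTopology.multipliable_one_add_of_tendsto_order_atTop_nhds_top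
  refine tendsto_of_tendsto_of_tendsto_of_le_of_le
    (g := fun i : ℕ => (i : ℕ∞)) (h := fun _ => ⊤) ?_ tendsto_const_nhds ?_ ?_
  · exact ENat.tendsto_nhds_top_iff_natCast_lt.mpr fun n =>
      (Filter.eventually_gt_atTop n).mono fun i hi => by exact_mod_cast hi
  · intro i
    show (i : ℕ∞) ≤ (-(a * b ^ i)).order
    rw [PowerSeries.order_neg]
    exact (PowerSeries.le_order_pow_of_constantCoeff_eq_zero i hb).trans
      ((le_add_of_nonneg_left zero_le).trans (PowerSeries.le_order_mul _ _))
  · intro i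
    exact le_top

/-- The constant term of `(q; q)_∞` is `1`, so that `PowerSeries.invOfUnit _ 1` is its inverse. -/
theorem qPochInf_mul_invOfUnit :
    qPochInf PowerSeries.X PowerSeries.X *
      PowerSeries.invOfUnit (qPochInf PowerSeries.X PowerSeries.X) 1 = 1 := by
  apply PowerSeries.mul_invOfUnit
  rw [qPochInf, (qPochInf_multipliable PowerSeries.X PowerSeries.X (by simp)).map_tprod
    (PowerSeries.constantCoeff (R := ℤ)) (PowerSeries.WithPiTopology.continuous_constantCoeff ℤ)]
  simp

/-!
Let `F m L` be the generating function of the anti-lecture hall compositions `l` with first entry at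
most `m` and at most `L` nonzero entries. Cutting `l` after its initial run of `n` entries with
`l i ≥ i + 1` leaves, after subtracting `1, 2, …, n`, a composition counted by `F (m - 1) n`,
followed by an ordinary partition in an `(L - n) × n` box, since the anti-lecture hall condition on
entries `l i ≤ i` is just monotonicity. Hence (`alhGF_succ_left`)
`F m L = ∑ n ≤ L, q^(1 + ⋯ + n) [L, n]_q F (m - 1) n`.

This is exactly one step of a Bailey chain with `a = q`, `ρ₁ → ∞`, `ρ₂ = -q`, for which the factors
`(-q; q)_n` telescope (`bailey_step`, which rests on the `q`-Chu–Vandermonde sum). Starting from the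
unit Bailey pair (`bailey_unit`), `m + 1` steps give (`bailey_chain`)
`F m L = (q; q)_L (-q; q)_L ∑ r ≤ L, (-1)^r q^(r(r-1)/2 + (m+1) r(r+1)/2) (1 - q^(2r+1))
  / ((q; q)_{L-r} (q; q)_{L+r+1})`.

As `L → ∞` the coefficients of `F m L` become the counts of all compositions with first entry at
most `m` (`coeff_alhGF`), while the right-hand side tends to `(-q; q)_∞ / (q; q)_∞` times a theta
series which the Jacobi triple product (`jacobi_triple`, the limit of a case of the finite
`q`-binomial theorem) evaluates as `(q; q^k)_∞ (q^(k-1); q^k)_∞ (q^k; q^k)_∞` with `k = m + 2`.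

The same product is the generating function of the overpartitions in question
(`genFun_overlineCount`): a part size contributes `(1 + q^p) / (1 - q^p)` if it is unrestricted, and
`1 + q^p` if it may only occur overlined.
-/

open Finset Filter Topology

/-! ### Gaussian binomials and the Bailey chain -/

section Algebra

variable {R : Type*} [CommRing R]

/-- The finite `q`-Pochhammer symbol `(a; q)_n = ∏_{i < n} (1 - a qⁱ)`. -/
def qPoch (a q : R) (n : ℕ) : R := ∏ i ∈ range n, (1 - a * q ^ i)

@[simp] lemma qPoch_zero (a q : R) : qPoch a q 0 = 1 := by simp [qPoch]

lemma qPoch_succ (a q : R) (n : ℕ) : qPoch a q (n + 1) = qPoch a q n * (1 - a * q ^ n) :=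
  prod_range_succ _ _

lemma qPoch_succ' (a q : R) (n : ℕ) : qPoch a q (n + 1) = (1 - a) * qPoch (a * q) q n := by
  simp only [qPoch, prod_range_succ', pow_zero, mul_one, mul_comm (1 - a)]
  congr 1
  exact prod_congr rfl fun i _ => by ring

lemma qPoch_add (a q : R) (m n : ℕ) :
    qPoch a q (m + n) = qPoch a q m * qPoch (a * q ^ m) q n := by
  simp only [qPoch, prod_range_add]
  congr 1
  exact prod_congr rfl fun i _ => by ring

/-- The Gaussian binomial coefficient, defined as a polynomial expression in `q` by the Pascal rule
`[n+1, j+1] = [n, j] + q^(j+1) [n, j+1]`. -/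
def qBinom (q : R) : ℕ → ℕ → R
  | _, 0 => 1
  | 0, _ + 1 => 0
  | n + 1, j + 1 => qBinom q n j + q ^ (j + 1) * qBinom q n (j + 1)

@[simp] lemma qBinom_zero_right (q : R) (n : ℕ) : qBinom q n 0 = 1 := by
  cases n <;> rfl

lemma qBinom_succ_succ (q : R) (n j : ℕ) :
    qBinom q (n + 1) (j + 1) = qBinom q n j + q ^ (j + 1) * qBinom q n (j + 1) := rfl

lemma qBinom_eq_zero (q : R) {n j : ℕ} (h : n < j) : qBinom q n j = 0 := by
  induction n generalizing j with
  | zero => cases j with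
    | zero => omega
    | succ j => rfl
  | succ n ih => cases j with
    | zero => omega
    | succ j => rw [qBinom_succ_succ, ih (by omega), ih (by omega)]; simp

@[simp] lemma qBinom_self (q : R) (n : ℕ) : qBinom q n n = 1 := by
  induction n with
  | zero => rfl
  | succ n ih => rw [qBinom_succ_succ, ih, qBinom_eq_zero q (Nat.lt_succ_self n)]; simp

lemma qBinom_add_mul_qPoch (q : R) (a b : ℕ) :
    qBinom q (a + b) a * (qPoch q q a * qPoch q q b) = qPoch q q (a + b) := by
  induction h : a + b generalizing a b with
  | zero =>
    obtain ⟨rfl, rfl⟩ : a = 0 ∧ b = 0 := by omega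
    simp
  | succ n ih =>
    rcases a with _ | a
    · obtain rfl : b = n + 1 := by omega
      simp
    rcases b with _ | b
    · obtain rfl : a = n := by omega
      simp
    have h1 := ih a (b + 1) (by omega)
    have h2 := ih (a + 1) b (by omega)
    obtain rfl : n = a + b + 1 := by omega
    rw [qBinom_succ_succ, qPoch_succ q q (a + b + 1)]
    rw [qPoch_succ] at h1 h2 ⊢
    rw [qPoch_succ q q b]
    linear_combination (1 - q * q ^ a) * h1 + q ^ (a + 1) * (1 - q * q ^ b) * h2

/-- The Pascal rule in summed form. -/
lemma sum_qBinom_succ_mul (q : R) (n : ℕ) (f : ℕ → R) :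
    ∑ j ∈ range (n + 2), qBinom q (n + 1) j * f j =
      ∑ j ∈ range (n + 1), qBinom q n j * (q ^ j * f j + f (j + 1)) := by
  rw [sum_range_succ']
  simp only [qBinom_succ_succ, add_mul, mul_add, sum_add_distrib]
  have h : ∑ j ∈ range (n + 1), qBinom q n j * (q ^ j * f j) =
      ∑ j ∈ range (n + 1), q ^ (j + 1) * qBinom q n (j + 1) * f (j + 1) + f 0 := by
    have := sum_range_succ' (fun j => qBinom q n j * (q ^ j * f j)) (n + 1)
    rw [sum_range_succ, qBinom_eq_zero q (Nat.lt_succ_self n)] at this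
    simp only [zero_mul, add_zero, qBinom_zero_right, pow_zero, one_mul] at this
    rw [this]
    congr 1
    exact sum_congr rfl fun j _ => by ring
  rw [h]
  simp only [qBinom_zero_right, one_mul]
  ring

lemma choose_two_succ (j : ℕ) : (j + 1).choose 2 = j.choose 2 + j := by
  rw [Nat.choose_succ_succ', Nat.choose_one_right, add_comm]

/-- The (homogeneous) `q`-binomial theorem. -/
lemma prod_sub_mul_pow (q x y : R) (n : ℕ) :
    ∏ i ∈ range n, (y - x * q ^ i) =
      ∑ j ∈ range (n + 1), qBinom q n j * ((-x) ^ j * q ^ j.choose 2 * y ^ (n - j)) := by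
  induction n generalizing x with
  | zero => simp
  | succ n ih =>
    rw [sum_qBinom_succ_mul, prod_range_succ']
    have h := ih (x * q)
    have h' : ∏ k ∈ range n, (y - x * q ^ (k + 1)) = ∏ i ∈ range n, (y - x * q * q ^ i) :=
      prod_congr rfl fun i _ => by ring
    rw [h', h, sum_mul]
    refine sum_congr rfl fun j hj => ?_
    have hj : j ≤ n := by simpa [Nat.lt_succ_iff] using hj
    rw [show n + 1 - j = (n - j) + 1 by omega, show n + 1 - (j + 1) = n - j by omega,
      choose_two_succ, show -(x * q) = -x * q by ring, mul_pow]
    ring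

/-- The `q`-Chu–Vandermonde sum `∑ [n, j] (-x)^j q^(j choose 2) (b; q)_j / (bx; q)_j =
(x; q)_n / (bx; q)_n`, cleared of denominators. The Pascal rule reduces it to the same sum with `x`
replaced by `x q`. -/
lemma sum_qBinom_qPoch_mul_qPoch (q b x : R) (n : ℕ) :
    ∑ j ∈ range (n + 1), qBinom q n j *
      ((-x) ^ j * q ^ j.choose 2 * (qPoch b q j * qPoch (b * x * q ^ j) q (n - j))) =
      qPoch x q n := by
  induction n generalizing x with
  | zero => simp
  | succ n ih =>
    rw [sum_qBinom_succ_mul, qPoch_succ', ← ih (x * q), mul_sum]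
    refine sum_congr rfl fun j hj => ?_
    have hj : j ≤ n := by simpa [Nat.lt_succ_iff] using hj
    rw [show n + 1 - j = (n - j) + 1 by omega, show n + 1 - (j + 1) = n - j by omega,
      choose_two_succ, show -(x * q) = -x * q by ring, mul_pow, qPoch_succ', qPoch_succ,
      show b * (x * q) * q ^ j = b * x * q ^ j * q by ring,
      show b * x * q ^ (j + 1) = b * x * q ^ j * q by ring]
    ring

/-! Below, `u n` stands for `1 / (q; q)_n`. -/

section Bailey

variable {q : R} {u : ℕ → R}

lemma qBinom_mul_inv (hu : ∀ n, qPoch q q n * u n = 1) (a b : ℕ) :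
    qBinom q (a + b) a * u (a + b) = u a * u b := by
  linear_combination u (a + b) * u a * u b * qBinom_add_mul_qPoch q a b
    - qBinom q (a + b) a * u (a + b) * qPoch q q b * u b * hu a
    - qBinom q (a + b) a * u (a + b) * hu b + u a * u b * hu (a + b)

/-- The kernel of the Bailey lemma with `a = q`, `ρ₁ → ∞`, `ρ₂ = -q`: the `q`-Chu–Vandermonde sum
with `b = x = -q^(s+1)`, divided by `(q; q)_n (q; q)_(n+2s+1)`. -/
lemma sum_bailey_kernel (hu : ∀ n, qPoch q q n * u n = 1) (s n : ℕ) :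
    ∑ j ∈ range (n + 1), q ^ (s + j + 1).choose 2 * qPoch (-q) q (s + j) *
      (u (n - j) * u j * u (j + 2 * s + 1)) =
      q ^ (s + 1).choose 2 * qPoch (-q) q (s + n) * (u n * u (n + 2 * s + 1)) := by
  have hV := sum_qBinom_qPoch_mul_qPoch q (-q ^ (s + 1)) (-q ^ (s + 1)) n
  have hexp : ∀ j, (s + j + 1).choose 2 = (s + 1).choose 2 + ((s + 1) * j + j.choose 2) := by
    intro j
    induction j with
    | zero => simp
    | succ j ih =>
      rw [← add_assoc, choose_two_succ, ih, choose_two_succ j]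
      ring
  rw [qPoch_add, show -q * q ^ s = -q ^ (s + 1) by ring, ← hV]
  simp only [mul_sum, sum_mul]
  refine sum_congr rfl fun j hj => ?_
  obtain ⟨i, rfl⟩ : ∃ i, n = j + i := Nat.exists_eq_add_of_le (by
    simpa [Nat.lt_succ_iff] using hj)
  have h1 := qBinom_mul_inv hu j i
  have h2 : qPoch (q ^ (2 * s + 2) * q ^ j) q i * u (j + i + 2 * s + 1) = u (j + 2 * s + 1) := by
    have h3 := qPoch_add q q (j + 2 * s + 1) i
    rw [show q * q ^ (j + 2 * s + 1) = q ^ (2 * s + 2) * q ^ j by ring,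
      show j + 2 * s + 1 + i = j + i + 2 * s + 1 by ring] at h3
    linear_combination u (j + 2 * s + 1) * hu (j + i + 2 * s + 1)
      - u (j + i + 2 * s + 1) * u (j + 2 * s + 1) * h3
      - qPoch (q ^ (2 * s + 2) * q ^ j) q i * u (j + i + 2 * s + 1) * hu (j + 2 * s + 1)
  rw [hexp, qPoch_add, show -q * q ^ s = -q ^ (s + 1) by ring, neg_neg, Nat.add_sub_cancel_left,
    show -q ^ (s + 1) * -q ^ (s + 1) = q ^ (2 * s + 2) by ring, ← h2, mul_comm (u i), ← h1]
  ring

/-- One step of the Bailey chain: passing from `P` to `∑ q^(i(i+1)/2) [n, i] P i` multiplies the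
coefficient `a r` by `q^(r(r+1)/2)`. -/
lemma bailey_step (hu : ∀ n, qPoch q q n * u n = 1) {P a : ℕ → R}
    (hP : ∀ n, P n * u n =
      qPoch (-q) q n * ∑ r ∈ range (n + 1), a r * (u (n - r) * u (n + r + 1))) (n : ℕ) :
    (∑ i ∈ range (n + 1), q ^ (i + 1).choose 2 * qBinom q n i * P i) * u n =
      qPoch (-q) q n *
        ∑ r ∈ range (n + 1), (q ^ (r + 1).choose 2 * a r) * (u (n - r) * u (n + r + 1)) := by
  have h1 : ∀ i ∈ range (n + 1), q ^ (i + 1).choose 2 * qBinom q n i * P i * u n =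
      ∑ r ∈ range (i + 1), a r * (q ^ (i + 1).choose 2 * qPoch (-q) q i *
        (u (n - i) * u (i - r) * u (i + r + 1))) := by
    intro i hi
    obtain ⟨d, rfl⟩ : ∃ d, n = i + d := Nat.exists_eq_add_of_le (by
      simpa [Nat.lt_succ_iff] using hi)
    have h := qBinom_mul_inv hu i d
    calc _ = q ^ (i + 1).choose 2 * u d * (P i * u i) := by
          linear_combination q ^ (i + 1).choose 2 * P i * h
      _ = _ := by
          rw [hP, mul_sum, mul_sum]
          refine sum_congr rfl fun r _ => ?_
          rw [Nat.add_sub_cancel_left]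
          ring
  rw [sum_mul, sum_congr rfl h1, mul_sum]
  rw [sum_comm' (t' := range (n + 1)) (s' := fun r => Ico r (n + 1))]
  · refine sum_congr rfl fun r hr => ?_
    obtain ⟨d, rfl⟩ : ∃ d, n = r + d := Nat.exists_eq_add_of_le (by
      simpa [Nat.lt_succ_iff] using hr)
    rw [← mul_sum, sum_Ico_eq_sum_range, show r + d + 1 - r = d + 1 by omega]
    have h := sum_bailey_kernel hu r d
    rw [show r + d + r + 1 = d + 2 * r + 1 by ring, Nat.add_sub_cancel_left]
    trans a r * (q ^ (r + 1).choose 2 * qPoch (-q) q (r + d) * (u d * u (d + 2 * r + 1)))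
    · rw [← h]
      congr 1
      refine sum_congr rfl fun j _ => ?_
      rw [show r + d - (r + j) = d - j by omega, show r + j - r = j by omega,
        show r + j + r + 1 = j + 2 * r + 1 by ring]
    · ring
  · intro i r
    simp only [mem_range, mem_Ico]
    omega

/-- The unit Bailey pair with `a = q`: the sum vanishes for `n > 0`, because `1 - q^n` times it
telescopes. -/
lemma bailey_unit (hu : ∀ n, qPoch q q n * u n = 1) (n : ℕ) :
    (if n = 0 then 1 else 0) * u n = qPoch (-q) q n *
      ∑ r ∈ range (n + 1), ((-1) ^ r * q ^ r.choose 2 * (1 - q ^ (2 * r + 1))) *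
        (u (n - r) * u (n + r + 1)) := by
  have hsucc : ∀ m, u m = (1 - q ^ (m + 1)) * u (m + 1) := by
    intro m
    have h := qPoch_succ q q m
    linear_combination (1 - q ^ (m + 1)) * u (m + 1) * hu m - u m * hu (m + 1)
      + u m * u (m + 1) * h
  rcases n with _ | n
  · have h0 : u 0 = 1 := by simpa using hu 0
    have h1 := hsucc 0
    simp [h0] at h1 ⊢
    exact h1
  have htel : ∀ m ≤ n, (1 - q ^ (n + 1)) * ∑ r ∈ range (m + 1),
      ((-1) ^ r * q ^ r.choose 2 * (1 - q ^ (2 * r + 1))) *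
        (u (n + 1 - r) * u (n + 1 + r + 1)) =
      (-1) ^ m * q ^ (m + 1).choose 2 * (1 - q ^ (m + 1)) *
        (u (n - m) * u (n + m + 2)) := by
    intro m hm
    induction m with
    | zero =>
      simp only [zero_add, range_one, sum_singleton, Nat.sub_zero, add_zero, mul_zero, pow_zero,
        pow_one]
      rw [hsucc n]
      simp
      ring
    | succ m ih =>
      obtain ⟨d, rfl⟩ : ∃ d, n = m + 1 + d := Nat.exists_eq_add_of_le hm
      rw [sum_range_succ, mul_add, ih (by omega), choose_two_succ (m + 1)]
      have e1 := hsucc (m + 1 + d + m + 2)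
      have e2 := hsucc d
      rw [show m + 1 + d - m = d + 1 by omega, show m + 1 + d + 1 - (m + 1) = d + 1 by omega,
        show m + 1 + d - (m + 1) = d by omega,
        show m + 1 + d + 1 + (m + 1) + 1 = m + 1 + d + m + 2 + 1 by ring,
        show m + 1 + d + (m + 1) + 2 = m + 1 + d + m + 2 + 1 by ring, e1, e2]
      ring
  -- `1 - q ^ (n + 1)` divides `(q; q)_(n + 1)`, so it is invertible and can be cancelled in `hz`
  have hunit : (1 - q ^ (n + 1)) * (qPoch q q n * u (n + 1)) = 1 := by
    have h := qPoch_succ q q n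
    linear_combination hu (n + 1) - u (n + 1) * h
  have hlast := htel n le_rfl
  rw [Nat.sub_self] at hlast
  have hz : (1 - q ^ (n + 1)) * ∑ r ∈ range (n + 1 + 1),
      ((-1) ^ r * q ^ r.choose 2 * (1 - q ^ (2 * r + 1))) *
        (u (n + 1 - r) * u (n + 1 + r + 1)) = 0 := by
    have e1 := hsucc (n + n + 2)
    rw [sum_range_succ, mul_add, hlast, Nat.sub_self,
      show n + 1 + (n + 1) + 1 = n + n + 2 + 1 by ring, e1, choose_two_succ n]
    ring
  simp only [Nat.add_eq_zero_iff, one_ne_zero, and_false, if_false, zero_mul]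
  linear_combination (-(qPoch (-q) q (n + 1) * (qPoch q q n * u (n + 1)))) * hz
    + (qPoch (-q) q (n + 1) * ∑ r ∈ range (n + 1 + 1),
      ((-1) ^ r * q ^ r.choose 2 * (1 - q ^ (2 * r + 1))) *
        (u (n + 1 - r) * u (n + 1 + r + 1))) * hunit

end Bailey

end Algebra

/-! ### Finite form of the Jacobi triple product -/

lemma choose_two_add (a b : ℕ) : (a + b).choose 2 = a.choose 2 + a * b + b.choose 2 := by
  induction b with
  | zero => simp
  | succ b ih => rw [← add_assoc, choose_two_succ, ih, choose_two_succ]; ring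

lemma two_mul_choose_two_add (s : ℕ) : 2 * s.choose 2 + s = s * s := by
  induction s with
  | zero => simp
  | succ s ih => rw [choose_two_succ]; linarith

lemma prod_pow_sub_mul_pow {R : Type*} [CommRing R] {z w q : R} (hzw : z * w = q) (n : ℕ) :
    ∏ i ∈ range n, (q ^ n - z * q ^ i) = (-z) ^ n * q ^ n.choose 2 * qPoch w q n := by
  have h1 : ∀ i ∈ range n, q ^ n - z * q ^ i = (-z * q ^ i) * (1 - w * q ^ (n - 1 - i)) := by
    intro i hi
    obtain ⟨d, rfl⟩ : ∃ d, n = i + 1 + d := Nat.exists_eq_add_of_le (mem_range.mp hi)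
    rw [show i + 1 + d - 1 - i = d by omega]
    linear_combination (-(q ^ i * q ^ d)) * hzw
  have h2 : ∀ m : ℕ, ∏ i ∈ range m, (-z * q ^ i) = (-z) ^ m * q ^ m.choose 2 := by
    intro m
    induction m with
    | zero => simp
    | succ m ih => rw [prod_range_succ, ih, choose_two_succ]; ring
  rw [prod_congr rfl h1, prod_mul_distrib, h2, prod_range_reflect (fun i => 1 - w * q ^ i)]
  rfl

/-- A finite form of the Jacobi triple product identity. It is the homogeneous `q`-binomial theorem
for `∏ i < 2n+1, (q^(n+1) - z q^i)`, with the terms `j = n - r` and `j = n + 1 + r` paired. The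
variable `w` plays the role of `q / z`, and the base `q^(n+1)` avoids negative powers. -/
lemma finite_jacobi {R : Type*} [CommRing R] [IsDomain R] {z w q : R} {u : ℕ → R}
    (hzw : z * w = q) (hq : q ≠ 0) (hu : ∀ n, qPoch q q n * u n = 1) (n : ℕ) :
    qPoch z q n * qPoch w q (n + 1) * u (2 * n + 1) = ∑ r ∈ range (n + 1),
      (-1) ^ r * (q ^ r.choose 2 * z ^ r - q ^ (r + 1).choose 2 * w ^ (r + 1)) *
        (u (n - r) * u (n + r + 1)) := by
  have hz : z ≠ 0 := by
    rintro rfl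
    exact hq (by simpa using hzw.symm)
  -- both sides are compared after multiplication by the common factor of all terms
  have hK : (-z) ^ (n + 1) * q ^ (n + 1).choose 2 * q ^ ((n + 1) * n) ≠ 0 :=
    mul_ne_zero (mul_ne_zero (pow_ne_zero _ (neg_ne_zero.mpr hz)) (pow_ne_zero _ hq))
      (pow_ne_zero _ hq)
  refine mul_left_cancel₀ hK ?_
  have hL := prod_sub_mul_pow q z (q ^ (n + 1)) (n + 1 + n)
  have h2 : ∏ i ∈ range n, (q ^ (n + 1) - z * q ^ (n + 1 + i)) =
      q ^ ((n + 1) * n) * qPoch z q n := by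
    have h3 : ∀ i ∈ range n, q ^ (n + 1) - z * q ^ (n + 1 + i) =
        q ^ (n + 1) * (1 - z * q ^ i) := fun i _ => by ring
    rw [prod_congr rfl h3, prod_mul_distrib, prod_const, card_range, pow_mul]
    rfl
  rw [prod_range_add, h2, prod_pow_sub_mul_pow hzw, show n + 1 + n + 1 = (n + 1) + (n + 1) by ring,
    sum_range_add, ← sum_range_reflect _ (n + 1), ← sum_add_distrib] at hL
  calc _ = (-z) ^ (n + 1) * q ^ (n + 1).choose 2 * qPoch w q (n + 1) *
        (q ^ ((n + 1) * n) * qPoch z q n) * u (n + 1 + n) := by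
        rw [show 2 * n + 1 = n + 1 + n by ring]; ring
    _ = _ := by
        rw [hL, sum_mul, mul_sum]
        refine sum_congr rfl fun r hr => ?_
        obtain ⟨d, rfl⟩ : ∃ d, n = r + d := Nat.exists_eq_add_of_le (by
          simpa [Nat.lt_succ_iff] using hr)
        have hb1 := qBinom_mul_inv hu d (r + d + r + 1)
        have hb2 := qBinom_mul_inv hu (r + d + r + 1) d
        rw [show r + d + 1 - 1 - r = d by omega, show r + d - r = d by omega,
          show r + d + 1 + (r + d) - d = r + d + r + 1 by omega,
          show r + d + 1 + (r + d) - (r + d + 1 + r) = d by omega,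
          show r + d + 1 + r = r + d + r + 1 by ring]
        rw [show d + (r + d + r + 1) = r + d + 1 + (r + d) by ring] at hb1
        rw [show r + d + r + 1 + d = r + d + 1 + (r + d) by ring] at hb2
        have e1 : (-z) ^ d * q ^ d.choose 2 * (q ^ (r + d + 1)) ^ (r + d + r + 1) =
            (-z) ^ (r + d + 1) * q ^ (r + d + 1).choose 2 * q ^ ((r + d + 1) * (r + d)) *
              ((-1) ^ (r + 1) * q ^ (r + 1).choose 2 * w ^ (r + 1)) := by
          have hs := two_mul_choose_two_add (r + 1)
          have hexp : d.choose 2 + (r + d + 1) * (r + d + r + 1) =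
              (r + 1) + ((r + d + 1).choose 2 + (r + d + 1) * (r + d) + (r + 1).choose 2) := by
            rw [show r + d + 1 = d + (r + 1) by ring, choose_two_add d]
            linarith
          calc _ = (-z) ^ d * q ^ (d.choose 2 + (r + d + 1) * (r + d + r + 1)) := by
                rw [← pow_mul, mul_assoc, ← pow_add]
            _ = (-z) ^ d * ((z * w) ^ (r + 1) * q ^ ((r + d + 1).choose 2 +
                  (r + d + 1) * (r + d) + (r + 1).choose 2)) := by
                rw [hexp, pow_add q (r + 1), hzw]
            _ = _ := by
                rw [show r + d + 1 = d + (r + 1) by ring, pow_add (-z), neg_pow z (r + 1)]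
                have : ((-1 : R) ^ (r + 1)) * (-1) ^ (r + 1) = 1 := by
                  rw [← mul_pow]; simp
                linear_combination (-((-z) ^ d * (z * w) ^ (r + 1) * q ^ ((d + (r + 1)).choose 2 +
                  (d + (r + 1)) * (r + d) + (r + 1).choose 2))) * this
        have e2 : (-z) ^ (r + d + r + 1) * q ^ (r + d + r + 1).choose 2 * (q ^ (r + d + 1)) ^ d =
            (-z) ^ (r + d + 1) * q ^ (r + d + 1).choose 2 * q ^ ((r + d + 1) * (r + d)) *
              ((-1) ^ r * q ^ r.choose 2 * z ^ r) := by
          rw [show r + d + r + 1 = r + d + 1 + r by ring, choose_two_add (r + d + 1) r,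
            pow_add (-z), neg_pow z r]
          ring
        rw [e1, e2, add_mul]
        rw [mul_right_comm, hb1, mul_right_comm (qBinom q _ (r + d + r + 1)), hb2]
        ring

/-! ### Limits of formal power series -/

lemma tendsto_qPoch (a b : ℤ⟦X⟧) (hb : PowerSeries.constantCoeff b = 0) :
    Tendsto (qPoch a b) atTop (𝓝 (qPochInf a b)) :=
  (qPochInf_multipliable a b hb).hasProd.tendsto_prod_nat

lemma tendsto_iff_eventually_coeff_eq {f : ℕ → ℤ⟦X⟧} {g : ℤ⟦X⟧} :
    Tendsto f atTop (𝓝 g) ↔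
      ∀ d, ∀ᶠ n in atTop, PowerSeries.coeff d (f n) = PowerSeries.coeff d g := by
  rw [PowerSeries.WithPiTopology.tendsto_iff_coeff_tendsto]
  simp only [nhds_discrete, tendsto_pure]

lemma tendsto_of_mul_eq_one {f g : ℕ → ℤ⟦X⟧} {f' g' : ℤ⟦X⟧} (hf : Tendsto f atTop (𝓝 f'))
    (h : ∀ n, f n * g n = 1) (h' : f' * g' = 1) : Tendsto g atTop (𝓝 g') := by
  rw [tendsto_iff_eventually_coeff_eq] at hf ⊢
  intro d
  have h1 : ∀ᶠ n in atTop, ∀ i ∈ range (d + 1),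
      PowerSeries.coeff i (f n) = PowerSeries.coeff i f' :=
    (Filter.eventually_all_finset _).mpr fun i _ => hf i
  filter_upwards [h1] with n hn
  have h2 : (PowerSeries.X : ℤ⟦X⟧) ^ (d + 1) ∣ f' - f n := by
    rw [PowerSeries.X_pow_dvd_iff]
    intro m hm
    rw [map_sub, hn m (mem_range.mpr hm), sub_self]
  have h3 : g n - g' = g n * g' * (f' - f n) := by
    linear_combination (-g n) * h' + g' * h n
  have h4 : (PowerSeries.X : ℤ⟦X⟧) ^ (d + 1) ∣ g n - g' := h3 ▸ Dvd.dvd.mul_left h2 _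
  have h5 := (PowerSeries.X_pow_dvd_iff.mp h4) d (Nat.lt_succ_self d)
  rwa [map_sub, sub_eq_zero] at h5

lemma tendsto_sum_range_of_X_pow_dvd {a : ℕ → ℤ⟦X⟧} (ha : ∀ r, PowerSeries.X ^ r ∣ a r) :
    Tendsto (fun n => ∑ r ∈ range n, a r) atTop
      (𝓝 (PowerSeries.mk fun d => PowerSeries.coeff d (∑ r ∈ range (d + 1), a r))) := by
  rw [tendsto_iff_eventually_coeff_eq]
  intro d
  filter_upwards [eventually_ge_atTop (d + 1)] with n hn
  rw [PowerSeries.coeff_mk, ← sum_range_add_sum_Ico _ hn, map_add, add_eq_left, map_sum]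
  refine sum_eq_zero fun r hr => ?_
  exact (PowerSeries.X_pow_dvd_iff.mp (ha r)) d (by simp at hr; omega)

/-- Passage to the limit in the sums produced by the Bailey chain. Since `X ^ r ∣ a r`, only the
terms with `r ≤ d` contribute to the coefficient of `X ^ d`. -/
lemma tendsto_sum_mul {a v : ℕ → ℤ⟦X⟧} {S v' : ℤ⟦X⟧} (ha : ∀ r, PowerSeries.X ^ r ∣ a r)
    (hS : Tendsto (fun n => ∑ r ∈ range n, a r) atTop (𝓝 S)) (hv : Tendsto v atTop (𝓝 v')) :
    Tendsto (fun n => ∑ r ∈ range (n + 1), a r * (v (n - r) * v (n + r + 1))) atTop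
      (𝓝 (S * (v' * v'))) := by
  rw [tendsto_iff_eventually_coeff_eq] at hS ⊢
  intro d
  have hcut : ∀ (b : ℕ → ℤ⟦X⟧) (n : ℕ), d + 1 ≤ n →
      PowerSeries.coeff d (∑ r ∈ range n, a r * b r) =
        PowerSeries.coeff d (∑ r ∈ range (d + 1), a r * b r) := by
    intro b n hn
    rw [← sum_range_add_sum_Ico _ hn, map_add, add_eq_left, map_sum]
    refine sum_eq_zero fun r hr => ?_
    exact (PowerSeries.X_pow_dvd_iff.mp (Dvd.dvd.mul_right (ha r) (b r))) d
      (by simp at hr; omega)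
  have h1 : Tendsto (fun n => ∑ r ∈ range (d + 1), a r * (v (n - r) * v (n + r + 1))) atTop
      (𝓝 (∑ r ∈ range (d + 1), a r * (v' * v'))) := by
    refine tendsto_finsetSum _ fun r _ => tendsto_const_nhds.mul (Tendsto.mul ?_ ?_)
    · exact hv.comp (tendsto_sub_atTop_nat r)
    · exact hv.comp (tendsto_atTop_mono (fun n => by simp only [id_eq]; omega) tendsto_id)
  have h2 : PowerSeries.coeff d (S * (v' * v')) =
      PowerSeries.coeff d (∑ r ∈ range (d + 1), a r * (v' * v')) := by
    have h3 := tendsto_iff_eventually_coeff_eq.mp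
      ((tendsto_iff_eventually_coeff_eq.mpr hS).mul_const (v' * v')) d
    obtain ⟨n, hn, hn'⟩ := (h3.and (eventually_ge_atTop (d + 1))).exists
    rw [← hn, sum_mul, hcut _ n hn']
  rw [h2]
  filter_upwards [tendsto_iff_eventually_coeff_eq.mp h1 d, eventually_ge_atTop d] with n hn hn'
  rw [← hn, hcut _ (n + 1) (by omega)]

lemma constantCoeff_qPoch_self (q : ℤ⟦X⟧) (hq : PowerSeries.constantCoeff q = 0) (n : ℕ) :
    PowerSeries.constantCoeff (qPoch q q n) = 1 := by
  simp [qPoch, map_prod, hq]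

lemma qPoch_mul_invOfUnit {q : ℤ⟦X⟧} (hq : PowerSeries.constantCoeff q = 0) (n : ℕ) :
    qPoch q q n * PowerSeries.invOfUnit (qPoch q q n) 1 = 1 :=
  PowerSeries.mul_invOfUnit _ _ (by simp [constantCoeff_qPoch_self q hq])

lemma qPochInf_self_mul_invOfUnit {q : ℤ⟦X⟧} (hq : PowerSeries.constantCoeff q = 0) :
    qPochInf q q * PowerSeries.invOfUnit (qPochInf q q) 1 = 1 := by
  refine PowerSeries.mul_invOfUnit _ _ ?_
  have h := tendsto_iff_eventually_coeff_eq.mp (tendsto_qPoch q q hq) 0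
  obtain ⟨n, hn⟩ := h.exists
  simp only [PowerSeries.coeff_zero_eq_constantCoeff] at hn
  rw [← hn, constantCoeff_qPoch_self q hq, Units.val_one]

/-- The Jacobi triple product identity for formal power series: if `z w = q`, then
`(z; q)_∞ (w; q)_∞ (q; q)_∞ = ∑_{r ≥ 0} (-1)^r (q^(r choose 2) z^r - q^(r+1 choose 2) w^(r+1))`. -/
lemma jacobi_triple {z w q S : ℤ⟦X⟧} (hzw : z * w = q) (hq : q ≠ 0)
    (hq0 : PowerSeries.constantCoeff q = 0)
    (hdvd : ∀ r, PowerSeries.X ^ r ∣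
      (-1) ^ r * (q ^ r.choose 2 * z ^ r - q ^ (r + 1).choose 2 * w ^ (r + 1)))
    (hS : Tendsto (fun n => ∑ r ∈ range n,
      (-1) ^ r * (q ^ r.choose 2 * z ^ r - q ^ (r + 1).choose 2 * w ^ (r + 1))) atTop (𝓝 S)) :
    S = qPochInf z q * qPochInf w q * qPochInf q q := by
  have hu := qPoch_mul_invOfUnit hq0
  have huI := qPochInf_self_mul_invOfUnit hq0
  set u := fun n => PowerSeries.invOfUnit (qPoch q q n) 1 with hu_def
  set v := PowerSeries.invOfUnit (qPochInf q q) 1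
  have hv : Tendsto u atTop (𝓝 v) := tendsto_of_mul_eq_one (tendsto_qPoch q q hq0) hu huI
  have h1 := tendsto_sum_mul hdvd hS hv
  have h2 : Tendsto (fun n => qPoch z q n * qPoch w q (n + 1) * u (2 * n + 1)) atTop
      (𝓝 (qPochInf z q * qPochInf w q * v)) := by
    refine Tendsto.mul (Tendsto.mul (tendsto_qPoch z q hq0) ?_) ?_
    · exact (tendsto_qPoch w q hq0).comp (tendsto_add_atTop_nat 1)
    · exact hv.comp (tendsto_atTop_mono (fun n => by simp only [id_eq]; omega) tendsto_id)
  have h3 := tendsto_nhds_unique h1 (h2.congr fun n => finite_jacobi hzw hq hu n)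
  linear_combination (qPochInf q q) ^ 2 * h3 - (S * (1 + qPochInf q q * v) -
    qPochInf z q * qPochInf w q * qPochInf q q) * huI

/-! ### The limit of the iterated Bailey chain -/

/-- Closed form of a family satisfying the recursion of the truncated anti-lecture hall generating
functions, obtained by iterating the Bailey chain on the unit pair. -/
lemma bailey_chain {R : Type*} [CommRing R] {q : R} {u : ℕ → R} {F : ℕ → ℕ → R}
    (hu : ∀ n, qPoch q q n * u n = 1) (hF0 : ∀ n, F 0 n = 1)
    (hF : ∀ m n, F (m + 1) n =
      ∑ i ∈ range (n + 1), q ^ (i + 1).choose 2 * qBinom q n i * F m i) (m n : ℕ) :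
    F m n * u n = qPoch (-q) q n * ∑ r ∈ range (n + 1),
      ((-1) ^ r * q ^ (r.choose 2 + (m + 1) * (r + 1).choose 2) * (1 - q ^ (2 * r + 1))) *
        (u (n - r) * u (n + r + 1)) := by
  induction m generalizing n with
  | zero =>
    -- one step turns the unit pair, concentrated at `n = 0`, into the constant `1`
    have h := bailey_step hu (bailey_unit hu) n
    rw [sum_range_succ', sum_eq_zero (fun i _ => by simp)] at h
    simp only [zero_add, if_true, mul_one, qBinom_zero_right, Nat.choose_succ_self, pow_zero,
      one_mul] at h
    rw [hF0, one_mul, h]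
    congr 1
    exact sum_congr rfl fun r _ => by ring
  | succ m ih =>
    rw [hF, bailey_step hu ih n]
    congr 1
    exact sum_congr rfl fun r _ => by ring

/-- The limit of the closed form `bailey_chain` for `q = X`. The triple product is taken in base
`X ^ (m + 2)`, with `z = X ^ (m + 1)` and `w = X`. -/
lemma tendsto_of_recursion {F : ℕ → ℕ → ℤ⟦X⟧} (hF0 : ∀ n, F 0 n = 1)
    (hF : ∀ m n, F (m + 1) n = ∑ i ∈ range (n + 1),
      PowerSeries.X ^ (i + 1).choose 2 * qBinom PowerSeries.X n i * F m i) (m : ℕ) :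
    Tendsto (F m) atTop (𝓝 (qPochInf (-PowerSeries.X) PowerSeries.X *
        PowerSeries.invOfUnit (qPochInf PowerSeries.X PowerSeries.X) 1 *
        (qPochInf PowerSeries.X (PowerSeries.X ^ (m + 2)) *
          qPochInf (PowerSeries.X ^ (m + 1)) (PowerSeries.X ^ (m + 2)) *
          qPochInf (PowerSeries.X ^ (m + 2)) (PowerSeries.X ^ (m + 2))))) := by
  have hX0 : PowerSeries.constantCoeff (PowerSeries.X : ℤ⟦X⟧) = 0 := by simp
  have hu := qPoch_mul_invOfUnit hX0
  have huI := qPochInf_self_mul_invOfUnit hX0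
  set q : ℤ⟦X⟧ := PowerSeries.X with hq_def
  set u := fun n => PowerSeries.invOfUnit (qPoch q q n) 1 with hu_def
  set v := PowerSeries.invOfUnit (qPochInf q q) 1
  have hv : Tendsto u atTop (𝓝 v) := tendsto_of_mul_eq_one (tendsto_qPoch q q hX0) hu huI
  set a : ℕ → ℤ⟦X⟧ := fun r =>
    (-1) ^ r * q ^ (r.choose 2 + (m + 1) * (r + 1).choose 2) * (1 - q ^ (2 * r + 1)) with ha_def
  have ha : ∀ r, q ^ r ∣ a r := by
    intro r
    refine Dvd.dvd.mul_right (Dvd.dvd.mul_left (pow_dvd_pow _ ?_) _) _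
    rw [choose_two_succ]
    nlinarith [Nat.zero_le (m * (r.choose 2 + r)), Nat.zero_le (r.choose 2)]
  obtain ⟨S, hS⟩ : ∃ S, Tendsto (fun n => ∑ r ∈ range n, a r) atTop (𝓝 S) :=
    ⟨_, tendsto_sum_range_of_X_pow_dvd ha⟩
  have hterm : ∀ r, a r = (-1) ^ r * ((q ^ (m + 2)) ^ r.choose 2 * (q ^ (m + 1)) ^ r -
      (q ^ (m + 2)) ^ (r + 1).choose 2 * q ^ (r + 1)) := by
    intro r
    simp only [ha_def, choose_two_succ]
    ring
  have hJ : S = _ := jacobi_triple (z := q ^ (m + 1)) (w := q) (q := q ^ (m + 2)) (S := S)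
    (by ring) (pow_ne_zero _ PowerSeries.X_ne_zero) (by simp [hX0])
    (fun r => hterm r ▸ ha r) (hS.congr fun n => sum_congr rfl fun r _ => hterm r)
  have h1 := (((tendsto_qPoch q q hX0).mul (tendsto_qPoch (-q) q hX0)).mul
    (tendsto_sum_mul ha hS hv))
  have h2 : ∀ n, qPoch q q n * qPoch (-q) q n *
      ∑ r ∈ range (n + 1), a r * (u (n - r) * u (n + r + 1)) = F m n := by
    intro n
    have h := bailey_chain hu hF0 hF m n
    linear_combination (-qPoch q q n) * h + F m n * hu n
  have h3 := h1.congr h2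
  convert h3 using 2
  rw [hJ]
  linear_combination (-(qPochInf (-q) q * v * (qPochInf q (q ^ (m + 2)) *
    qPochInf (q ^ (m + 1)) (q ^ (m + 2)) * qPochInf (q ^ (m + 2)) (q ^ (m + 2))))) * huI

/-! ### Generating functions of anti-lecture hall compositions -/

lemma finite_setOf_le_of_support (a B : ℕ) {s : Set (ℕ → ℕ)}
    (hB : ∀ p ∈ s, ∀ i, p i ≤ B) (h0 : ∀ p ∈ s, ∀ i, a ≤ i → p i = 0) : s.Finite := by
  refine Set.Finite.of_injOn (f := fun (p : ℕ → ℕ) (i : Fin a) => p i)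
    (t := Set.Iic (fun _ => B)) (fun p hp i => hB p hp i) ?_ (Set.finite_Iic _)
  intro p hp p' hp' h
  funext i
  by_cases hi : i < a
  · exact congrFun h ⟨i, hi⟩
  · rw [h0 p hp i (by omega), h0 p' hp' i (by omega)]

/-- Partitions with at most `a` parts, all of them at most `b`, as nonincreasing sequences padded
by zeros. -/
def boxPartitions (a b : ℕ) : Set (ℕ → ℕ) :=
  {p | Antitone p ∧ p 0 ≤ b ∧ ∀ i, a ≤ i → p i = 0}

lemma boxPartitions_finite (a b : ℕ) : (boxPartitions a b).Finite :=
  finite_setOf_le_of_support a b (fun _ hp i => (hp.1 (Nat.zero_le i)).trans hp.2.1)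
    fun _ hp => hp.2.2

/-- The set of anti-lecture hall compositions with first entry at most `m` and at most `L`
nonzero entries, as plain functions, with denominators cleared in the defining inequalities. -/
def truncatedALH (m L : ℕ) : Set (ℕ → ℕ) :=
  {l | (∀ i, l (i + 1) * (i + 1) ≤ l i * (i + 2)) ∧ l 0 ≤ m ∧ ∀ i, L ≤ i → l i = 0}

lemma le_mul_of_mem_truncatedALH {m L : ℕ} {l : ℕ → ℕ} (hl : l ∈ truncatedALH m L) (i : ℕ) :
    l i ≤ m * (i + 1) := by
  induction i with
  | zero => simpa using hl.2.1
  | succ i ih =>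
    have h := hl.1 i
    have h2 : l (i + 1) * (i + 1) ≤ m * (i + 1 + 1) * (i + 1) := by
      calc _ ≤ l i * (i + 2) := h
        _ ≤ m * (i + 1) * (i + 2) := Nat.mul_le_mul_right _ ih
        _ = _ := by ring
    exact Nat.le_of_mul_le_mul_right h2 (Nat.succ_pos i)

lemma truncatedALH_finite (m L : ℕ) : (truncatedALH m L).Finite := by
  refine finite_setOf_le_of_support L (m * L) (fun l hl i => ?_) fun _ hl => hl.2.2
  by_cases hi : i < L
  · exact (le_mul_of_mem_truncatedALH hl i).trans (Nat.mul_le_mul_left _ hi)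
  · simp [hl.2.2 i (by omega)]

section GenFun

variable {R : Type*} [CommRing R] (q : R)

/-- The generating function of `boxPartitions a b` by size. -/
noncomputable def boxGF (a b : ℕ) : R :=
  ∑ p ∈ (boxPartitions_finite a b).toFinset, q ^ ∑ i ∈ range a, p i

/-- The generating function of `truncatedALH m L` by weight. -/
noncomputable def alhGF (m L : ℕ) : R :=
  ∑ l ∈ (truncatedALH_finite m L).toFinset, q ^ ∑ i ∈ range L, l i

lemma boxGF_zero_left (b : ℕ) : boxGF q 0 b = 1 := by
  have h : (boxPartitions_finite 0 b).toFinset = {fun _ => 0} := by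
    ext p
    simp only [Set.Finite.mem_toFinset, mem_singleton]
    refine ⟨fun hp => funext fun i => hp.2.2 i (Nat.zero_le i), ?_⟩
    rintro rfl
    exact ⟨antitone_const, Nat.zero_le _, fun _ _ => rfl⟩
  simp [boxGF, h]

lemma boxGF_zero_right (a : ℕ) : boxGF q a 0 = 1 := by
  have h : (boxPartitions_finite a 0).toFinset = {fun _ => 0} := by
    ext p
    simp only [Set.Finite.mem_toFinset, mem_singleton]
    refine ⟨fun hp => funext fun i => ?_, ?_⟩
    · exact Nat.le_zero.mp ((hp.1 (Nat.zero_le i)).trans hp.2.1)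
    · rintro rfl
      exact ⟨antitone_const, Nat.zero_le _, fun _ _ => rfl⟩
  simp [boxGF, h]

/-- The partitions are split according to whether the largest part equals `b + 1`; if it does, it is
removed. -/
lemma boxGF_succ_succ (a b : ℕ) :
    boxGF q (a + 1) (b + 1) = boxGF q (a + 1) b + q ^ (b + 1) * boxGF q a (b + 1) := by
  classical
  unfold boxGF
  rw [← sum_filter_add_sum_filter_not (boxPartitions_finite (a + 1) (b + 1)).toFinset
    (fun p => p 0 ≤ b), mul_sum]
  congr 1
  · refine sum_congr ?_ fun _ _ => rfl
    ext p
    simp only [mem_filter, Set.Finite.mem_toFinset, boxPartitions, Set.mem_ofPred_eq]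
    constructor
    · rintro ⟨⟨h1, -, h3⟩, h⟩
      exact ⟨h1, h, h3⟩
    · rintro ⟨h1, h, h3⟩
      exact ⟨⟨h1, h.trans (Nat.le_succ b), h3⟩, h⟩
  · refine sum_nbij' (fun p i => p (i + 1)) (fun p i => if i = 0 then b + 1 else p (i - 1))
      ?_ ?_ ?_ ?_ ?_
    · intro p hp
      simp only [mem_filter, Set.Finite.mem_toFinset] at hp ⊢
      obtain ⟨⟨h1, h2, h3⟩, -⟩ := hp
      exact ⟨fun i j hij => h1 (Nat.succ_le_succ hij), (h1 (Nat.zero_le _)).trans h2,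
        fun i hi => h3 _ (Nat.succ_le_succ hi)⟩
    · intro p hp
      simp only [mem_filter, Set.Finite.mem_toFinset] at hp ⊢
      obtain ⟨h1, h2, h3⟩ := hp
      refine ⟨⟨antitone_nat_of_succ_le fun i => ?_, by simp, fun i hi => ?_⟩, by simp⟩
      · rcases i with _ | i
        · simpa using h2
        · simpa using h1 (Nat.le_succ i)
      · dsimp only
        rw [if_neg (by omega)]
        exact h3 _ (by omega)
    · intro p hp
      simp only [mem_filter, Set.Finite.mem_toFinset] at hp
      obtain ⟨⟨h1, h2, h3⟩, h⟩ := hp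
      funext i
      rcases i with _ | i
      · simp; omega
      · simp
    · intro p _
      simp
    · intro p hp
      simp only [mem_filter, Set.Finite.mem_toFinset] at hp
      obtain ⟨⟨h1, h2, h3⟩, h⟩ := hp
      rw [sum_range_succ', ← pow_add, add_comm]
      congr 2
      omega

/-- Gaussian binomial coefficients count partitions in a box. -/
lemma boxGF_eq_qBinom (a b : ℕ) : boxGF q a b = qBinom q (a + b) b := by
  induction a generalizing b with
  | zero => rw [boxGF_zero_left, zero_add, qBinom_self]
  | succ a iha =>
    induction b with
    | zero => rw [boxGF_zero_right, qBinom_zero_right]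
    | succ b ihb =>
      rw [boxGF_succ_succ, ihb, iha, ← add_assoc (a + 1), qBinom_succ_succ,
        show a + (b + 1) = a + 1 + b by ring]

lemma alhGF_zero_left (L : ℕ) : alhGF q 0 L = 1 := by
  have h : (truncatedALH_finite 0 L).toFinset = {fun _ => 0} := by
    ext l
    simp only [Set.Finite.mem_toFinset, mem_singleton]
    refine ⟨fun hl => funext fun i => ?_, ?_⟩
    · simpa using le_mul_of_mem_truncatedALH hl i
    · rintro rfl
      exact ⟨by simp, le_rfl, fun _ _ => rfl⟩
  simp [alhGF, h]

/-- The number of leading entries `l i` that are at least `i + 1`. (For a sequence without an entry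
`l i ≤ i` this is the junk value `0`; truncated compositions always have one.) -/
noncomputable def leadingLength (l : ℕ → ℕ) : ℕ := sInf {i | l i < i + 1}

lemma le_of_lt_leadingLength {l : ℕ → ℕ} {i : ℕ} (hi : i < leadingLength l) : i + 1 ≤ l i := by
  by_contra h
  exact Nat.notMem_of_lt_sInf hi (by simpa using h)

lemma leadingLength_eq {l : ℕ → ℕ} {n : ℕ} (h1 : ∀ i < n, i + 1 ≤ l i) (h2 : l n < n + 1) :
    leadingLength l = n := by
  refine le_antisymm (Nat.sInf_le h2) ?_
  by_contra h
  have h3 : l (leadingLength l) < leadingLength l + 1 :=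
    Nat.sInf_mem (s := {i | l i < i + 1}) ⟨n, h2⟩
  have := h1 _ (not_le.mp h)
  omega

/-- After the first entry `l i ≤ i` all entries satisfy `l i ≤ i`. -/
lemma lt_of_leadingLength_le {m L : ℕ} {l : ℕ → ℕ} (hl : l ∈ truncatedALH m L) {i : ℕ}
    (hi : leadingLength l ≤ i) : l i < i + 1 := by
  induction i, hi using Nat.le_induction with
  | base =>
    exact Nat.sInf_mem (s := {i | l i < i + 1}) ⟨L, by simp [hl.2.2 L le_rfl]⟩
  | succ i _ ih =>
    have h := hl.1 i
    by_contra h2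
    push Not at h2
    nlinarith

lemma leadingLength_le {m L : ℕ} {l : ℕ → ℕ} (hl : l ∈ truncatedALH m L) : leadingLength l ≤ L :=
  Nat.sInf_le (by simp [hl.2.2 L le_rfl])

lemma sum_range_succ_eq_choose (n : ℕ) : ∑ i ∈ range n, (i + 1) = (n + 1).choose 2 := by
  induction n with
  | zero => simp
  | succ n ih => rw [sum_range_succ, ih, choose_two_succ (n + 1)]

/-- The composition is cut after its leading entries `l i ≥ i + 1`: subtracting `i + 1` from these
leaves an anti-lecture hall composition with a smaller first entry, and the remaining entries, all
with `l i ≤ i`, form an ordinary partition. -/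
lemma alhGF_succ_left (m L : ℕ) :
    alhGF q (m + 1) L =
      ∑ n ∈ range (L + 1), q ^ (n + 1).choose 2 * qBinom q L n * alhGF q m n := by
  classical
  have hterm : ∀ n ∈ range (L + 1), q ^ (n + 1).choose 2 * qBinom q L n * alhGF q m n =
      ∑ x ∈ (truncatedALH_finite m n).toFinset ×ˢ (boxPartitions_finite (L - n) n).toFinset,
        q ^ (∑ i ∈ range n, (i + 1) + ∑ i ∈ range n, x.1 i + ∑ i ∈ range (L - n), x.2 i) := by
    intro n hn
    have hn : n ≤ L := by simpa [Nat.lt_succ_iff] using hn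
    have h := boxGF_eq_qBinom q (L - n) n
    rw [Nat.sub_add_cancel hn] at h
    rw [← h, sum_range_succ_eq_choose, sum_product, alhGF, boxGF, mul_sum]
    refine sum_congr rfl fun l _ => ?_
    rw [mul_assoc, mul_comm (∑ p ∈ _, _), mul_sum, mul_sum]
    exact sum_congr rfl fun p _ => by rw [pow_add, pow_add, mul_assoc]
  rw [sum_congr rfl hterm, sum_sigma', alhGF]
  refine sum_nbij' (fun l => ⟨leadingLength l, (fun i => if i < leadingLength l then l i - (i + 1)
      else 0), fun i => l (leadingLength l + i)⟩)
    (fun x i => if i < x.1 then x.2.1 i + (i + 1) else x.2.2 (i - x.1)) ?_ ?_ ?_ ?_ ?_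
  · intro l hl
    simp only [Set.Finite.mem_toFinset, mem_sigma, mem_product, mem_range] at hl ⊢
    have hlt := fun {i} => lt_of_leadingLength_le hl (i := i)
    have hle := fun {i} => le_of_lt_leadingLength (l := l) (i := i)
    refine ⟨Nat.lt_succ_of_le (leadingLength_le hl), ⟨fun i => ?_, ?_, fun i hi => ?_⟩,
      antitone_nat_of_succ_le fun i => ?_, ?_, fun i hi => ?_⟩
    · dsimp only
      by_cases h : i + 1 < leadingLength l
      · rw [if_pos h, if_pos (by omega)]
        obtain ⟨c, hc⟩ := Nat.exists_eq_add_of_le (hle h)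
        obtain ⟨d, hd⟩ := Nat.exists_eq_add_of_le (hle (Nat.lt_of_succ_lt h))
        have := hl.1 i
        rw [hc, hd] at this ⊢
        rw [Nat.add_sub_cancel_left, Nat.add_sub_cancel_left]
        nlinarith
      · rw [if_neg h]; simp
    · dsimp only
      split_ifs
      · have := hl.2.1
        omega
      · simp
    · dsimp only
      rw [if_neg (by omega)]
    · have h1 := hl.1 (leadingLength l + i)
      have h2 := hlt (i := leadingLength l + i) (by omega)
      rw [← add_assoc]
      by_contra h
      push Not at h
      nlinarith
    · have := hlt (i := leadingLength l) le_rfl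
      simp only [add_zero]
      omega
    · exact hl.2.2 _ (by omega)
  · rintro ⟨n, l, p⟩ h
    simp only [Set.Finite.mem_toFinset, mem_sigma, mem_product, mem_range] at h ⊢
    obtain ⟨hn, hl, hp⟩ := h
    have hpn : ∀ i, p i ≤ n := fun i => (hp.1 (Nat.zero_le i)).trans hp.2.1
    refine ⟨fun i => ?_, ?_, fun i hi => ?_⟩
    · dsimp only
      rcases lt_trichotomy (i + 1) n with h | h | h
      · rw [if_pos h, if_pos (by omega)]
        have := hl.1 i
        nlinarith
      · rw [if_neg (by omega), if_pos (by omega)]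
        have h1 := hpn (i + 1 - n)
        rw [← h] at h1
        calc _ ≤ (i + 1) * (i + 1) := Nat.mul_le_mul_right _ (by rwa [← h])
          _ ≤ (i + 1) * (i + 2) := Nat.mul_le_mul_left _ (by omega)
          _ ≤ _ := Nat.mul_le_mul_right _ (by omega)
      · rw [if_neg (by omega), if_neg (by omega)]
        exact Nat.mul_le_mul (hp.1 (by omega)) (by omega)
    · dsimp only
      split_ifs with h
      · have := hl.2.1
        omega
      · have := hpn (0 - n)
        omega
    · dsimp only
      by_cases h : i < n
      · omega
      · rw [if_neg h]
        exact hp.2.2 _ (by omega)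
  · intro l hl
    simp only [Set.Finite.mem_toFinset] at hl
    funext i
    by_cases h : i < leadingLength l
    · have := le_of_lt_leadingLength h
      simp only [h, if_true]
      omega
    · simp only [h, if_false]
      congr 1
      omega
  · rintro ⟨n, l, p⟩ h
    simp only [Set.Finite.mem_toFinset, mem_sigma, mem_product, mem_range] at h
    obtain ⟨hn, hl, hp⟩ := h
    have hN : leadingLength (fun i => if i < n then l i + (i + 1) else p (i - n)) = n := by
      refine leadingLength_eq (fun i hi => ?_) ?_
      · simp only [hi, if_true]; omega
      · have := hp.2.1
        simp only [lt_irrefl, if_false, Nat.sub_self]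
        omega
    simp only [hN]
    congr 2
    · funext i
      split_ifs with hi
      · omega
      · exact (hl.2.2 i (by omega)).symm
    · funext i
      rw [if_neg (by omega), Nat.add_sub_cancel_left]
  · intro l hl
    simp only [Set.Finite.mem_toFinset] at hl
    have hN := leadingLength_le hl
    obtain ⟨d, hd⟩ := Nat.exists_eq_add_of_le hN
    congr 1
    dsimp only
    rw [← sum_add_distrib, show L - leadingLength l = d by omega]
    conv_lhs => rw [hd, sum_range_add]
    congr 1
    refine sum_congr rfl fun i hi => ?_
    have hi := mem_range.mp hi
    have := le_of_lt_leadingLength hi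
    rw [if_pos hi]
    omega

end GenFun

lemma isAntiLectureHall_iff (l : ℕ →₀ ℕ) :
    IsAntiLectureHall l ↔ ∀ i, l (i + 1) * (i + 1) ≤ l i * (i + 2) := by
  refine forall_congr' fun i => ?_
  rw [div_le_div_iff₀ (by positivity) (by positivity)]
  exact_mod_cast Iff.rfl

/-- A zero entry forces all later entries to vanish, so a composition of weight at most `n` has at
most `n` nonzero entries. -/
lemma eq_zero_of_weight_le {l : ℕ →₀ ℕ} (hl : IsAntiLectureHall l) {n i : ℕ}
    (hw : weight l ≤ n) (hi : n ≤ i) : l i = 0 := by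
  by_contra h
  rw [isAntiLectureHall_iff] at hl
  have hne : ∀ j ≤ i, 0 < l j := by
    intro j hj
    induction hj using Nat.decreasingInduction with
    | self => exact Nat.pos_of_ne_zero h
    | of_succ j _ ih =>
      have := hl j
      by_contra h0
      have h0 : l j = 0 := by omega
      rw [h0] at this
      nlinarith
  have h1 : range (i + 1) ⊆ l.support := by
    intro j hj
    rw [Finsupp.mem_support_iff]
    exact (hne j (by simpa [Nat.lt_succ_iff] using hj)).ne'
  have h2 : i + 1 ≤ weight l := by
    calc i + 1 = ∑ j ∈ range (i + 1), 1 := by simp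
      _ ≤ ∑ j ∈ range (i + 1), l j := sum_le_sum fun j hj =>
          hne j (by simpa [Nat.lt_succ_iff] using hj)
      _ ≤ ∑ j ∈ l.support, l j := sum_le_sum_of_subset h1
  omega

lemma weight_eq_sum_range {l : ℕ →₀ ℕ} {L : ℕ} (h : ∀ i, L ≤ i → l i = 0) :
    weight l = ∑ i ∈ range L, l i := by
  refine Finsupp.sum_of_support_subset l (fun i hi => ?_) _ fun _ _ => rfl
  rw [mem_range]
  by_contra hL
  exact Finsupp.mem_support_iff.mp hi (h i (not_lt.mp hL))

lemma image_antiLectureHallBounded {m n L : ℕ} (h : n ≤ L) :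
    (fun l : ℕ →₀ ℕ => (l : ℕ → ℕ)) '' antiLectureHallBounded m n =
      {l | l ∈ truncatedALH m L ∧ n = ∑ i ∈ range L, l i} := by
  ext f
  constructor
  · rintro ⟨l, ⟨h1, h2, h3⟩, rfl⟩
    have h0 : ∀ i, L ≤ i → l i = 0 := fun i hi => eq_zero_of_weight_le h1 h2.le (h.trans hi)
    exact ⟨⟨(isAntiLectureHall_iff l).mp h1, h3, h0⟩, by rw [← weight_eq_sum_range h0, h2]⟩
  · rintro ⟨⟨h1, h2, h3⟩, h4⟩
    let l : ℕ →₀ ℕ := Finsupp.onFinset (range L) f fun i hi => by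
      by_contra hL
      exact hi (h3 i (by simpa using hL))
    exact ⟨l, ⟨(isAntiLectureHall_iff l).mpr h1, (weight_eq_sum_range (l := l) h3).trans h4.symm,
      h2⟩, rfl⟩

lemma antiLectureHallBounded_finite (m n : ℕ) : (antiLectureHallBounded m n).Finite := by
  refine Set.Finite.of_finite_image (f := fun l : ℕ →₀ ℕ => (l : ℕ → ℕ)) ?_
    DFunLike.coe_injective.injOn
  rw [image_antiLectureHallBounded le_rfl]
  exact (truncatedALH_finite m n).subset fun l hl => hl.1

lemma coeff_alhGF {m n L : ℕ} (h : n ≤ L) :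
    PowerSeries.coeff n (alhGF (PowerSeries.X : ℤ⟦X⟧) m L) =
      (antiLectureHallBounded m n).ncard := by
  classical
  rw [← Set.ncard_image_of_injective _ DFunLike.coe_injective, image_antiLectureHallBounded h,
    alhGF, map_sum]
  simp only [PowerSeries.coeff_X_pow]
  rw [sum_boole, ← Set.ncard_coe_finset]
  congr 2
  ext l
  simp

/-- The generating function of anti-lecture hall compositions with first entry at most `m`. -/
lemma hasSum_X_pow_weight {m : ℕ} {G : ℤ⟦X⟧}
    (hG : ∀ n, PowerSeries.coeff n G = (antiLectureHallBounded m n).ncard) :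
    HasSum (fun l : {l : ℕ →₀ ℕ // IsAntiLectureHall l ∧ l 0 ≤ m} =>
      (PowerSeries.X : ℤ⟦X⟧) ^ weight l.1) G := by
  classical
  rw [PowerSeries.WithPiTopology.hasSum_iff_hasSum_coeff]
  intro n
  have hfin := antiLectureHallBounded_finite m n
  let s : Finset {l : ℕ →₀ ℕ // IsAntiLectureHall l ∧ l 0 ≤ m} :=
    hfin.toFinset.subtype _
  have hs : ∀ l, l ∈ s ↔ n = weight l.1 := by
    intro l
    simp only [s, mem_subtype, Set.Finite.mem_toFinset]
    exact ⟨fun h => h.2.1.symm, fun h => ⟨l.2.1, h.symm, l.2.2⟩⟩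
  have hsum : HasSum (fun l : {l : ℕ →₀ ℕ // IsAntiLectureHall l ∧ l 0 ≤ m} =>
      PowerSeries.coeff n ((PowerSeries.X : ℤ⟦X⟧) ^ weight l.1)) (∑ l ∈ s,
        PowerSeries.coeff n ((PowerSeries.X : ℤ⟦X⟧) ^ weight l.1)) := by
    refine hasSum_sum_of_ne_finset_zero fun l hl => ?_
    rw [hs] at hl
    rw [PowerSeries.coeff_X_pow, if_neg hl]
  suffices h : PowerSeries.coeff n G = ∑ l ∈ s,
      PowerSeries.coeff n ((PowerSeries.X : ℤ⟦X⟧) ^ weight l.1) from h ▸ hsum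
  rw [hG, sum_congr rfl fun l hl => by
    rw [PowerSeries.coeff_X_pow, if_pos ((hs l).mp hl)]]
  rw [sum_const, nsmul_one, Set.ncard_eq_toFinset_card _ hfin, card_subtype,
    filter_true_of_mem fun l hl => ?_]
  rw [Set.Finite.mem_toFinset] at hl
  exact ⟨hl.1, hl.2.2⟩

/-! ### Generating functions of overpartitions -/

/-- The residue condition `p ≡ 0, 1, -1 (mod k)`. -/
def IsExcludedPart (k p : ℕ) : Prop :=
  (p : ℤ) ≡ 0 [ZMOD k] ∨ (p : ℤ) ≡ 1 [ZMOD k] ∨ (p : ℤ) ≡ -1 [ZMOD k]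

lemma isExcludedPart_iff {d M r : ℕ} (hr : r < d + 3) :
    IsExcludedPart (d + 3) ((d + 3) * M + r + 1) ↔ r = 0 ∨ r = d + 1 ∨ r = d + 2 := by
  have hneg : (-1 : ℤ) % ((d + 3 : ℕ) : ℤ) = d + 2 := by
    rw [← Int.add_emod_right, Int.emod_eq_of_lt] <;> push_cast <;> omega
  have hone : (1 : ℤ) % ((d + 3 : ℕ) : ℤ) = 1 := Int.emod_eq_of_lt (by omega) (by push_cast; omega)
  have hp : (((d + 3) * M + r + 1 : ℕ) : ℤ) % ((d + 3 : ℕ) : ℤ) =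
      if r = d + 2 then 0 else (r : ℤ) + 1 := by
    rw [show (((d + 3) * M + r + 1 : ℕ) : ℤ) = ((r : ℤ) + 1) + ((d + 3 : ℕ) : ℤ) * M by
      push_cast; ring, Int.add_mul_emod_self_left]
    split_ifs with h
    · subst h
      rw [show ((d + 2 : ℕ) : ℤ) + 1 = ((d + 3 : ℕ) : ℤ) by push_cast; ring, Int.emod_self]
    · exact Int.emod_eq_of_lt (by omega) (by push_cast; omega)
  unfold IsExcludedPart Int.ModEq
  rw [hp, hneg, hone, Int.zero_emod]
  split_ifs <;> omega

open Classical in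
/-- The number of ways of overlining `c ≥ 1` copies of the part `p` in an overpartition without
non-overlined excluded parts: the first summand counts the choice of an overlined first copy,
the second one the choice to overline nothing. -/
noncomputable def overlineCount (k p c : ℕ) : ℤ :=
  (if IsExcludedPart k p ∧ c ≠ 1 then 0 else 1) + (if IsExcludedPart k p then 0 else 1)

/-- An excluded part may only occur once, and then overlined. -/
lemma Overpartition.mem_avoiding_iff {k n : ℕ} (π : Overpartition n) :
    π ∈ overpartitionsAvoiding k n ↔
      (∀ i ∈ π.overlined, ¬ (IsExcludedPart k i ∧ π.partition.parts.count i ≠ 1)) ∧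
      ∀ i ∈ π.partition.parts.toFinset \ π.overlined, ¬ IsExcludedPart k i := by
  have hmem : ∀ i, i ∈ π.nonOverlined ↔ i ∈ π.partition.parts.toFinset ∧
      (i ∈ π.overlined → π.partition.parts.count i ≠ 1) := by
    intro i
    rw [Overpartition.nonOverlined, Multiset.mem_sub, Multiset.mem_toFinset,
      ← Multiset.one_le_count_iff_mem]
    by_cases hi : i ∈ π.overlined
    · rw [Multiset.count_eq_one_of_mem π.overlined.nodup hi]
      have := Multiset.one_le_count_iff_mem.mpr
        (Multiset.mem_toFinset.mp (π.overlined_subset hi))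
      simp only [hi, true_imp_iff]
      omega
    · rw [Multiset.count_eq_zero_of_notMem hi]
      simp only [hi, false_imp_iff, and_true]
      omega
  have hdef : π ∈ overpartitionsAvoiding k n ↔ ∀ i ∈ π.nonOverlined, ¬ IsExcludedPart k i := by
    refine forall₂_congr fun i _ => ?_
    simp only [IsExcludedPart, not_or]
  rw [hdef]
  constructor
  · intro h
    refine ⟨fun i hi hbad => ?_, fun i hi => ?_⟩
    · exact h i ((hmem i).mpr ⟨π.overlined_subset hi, fun _ => hbad.2⟩) hbad.1
    · rw [Finset.mem_sdiff] at hi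
      exact h i ((hmem i).mpr ⟨hi.1, fun hi' => absurd hi' hi.2⟩)
  · rintro ⟨h1, h2⟩ i hi hbad
    rw [hmem] at hi
    by_cases hO : i ∈ π.overlined
    · exact h1 i hO ⟨hbad, hi.2 hO⟩
    · exact h2 i (Finset.mem_sdiff.mpr ⟨hi.1, hO⟩) hbad

/-- `Overpartition n` as a finite sigma type. -/
def Overpartition.toSigma {n : ℕ} (π : Overpartition n) : (_ : n.Partition) × Finset ℕ :=
  ⟨π.partition, π.overlined⟩

lemma Overpartition.toSigma_injective (n : ℕ) :
    Function.Injective (Overpartition.toSigma (n := n)) := by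
  rintro ⟨p, O, h⟩ ⟨p', O', h'⟩ heq
  simp only [Overpartition.toSigma, Sigma.mk.injEq, heq_eq_eq] at heq
  obtain ⟨rfl, rfl⟩ := heq
  rfl

open Classical in
lemma image_overpartitionsAvoiding (k n : ℕ) :
    Overpartition.toSigma '' overpartitionsAvoiding k n =
      ((univ : Finset n.Partition).sigma fun p => p.parts.toFinset.powerset.filter fun O =>
        (∀ i ∈ O, ¬ (IsExcludedPart k i ∧ p.parts.count i ≠ 1)) ∧
          ∀ i ∈ p.parts.toFinset \ O, ¬ IsExcludedPart k i :
        Finset ((_ : n.Partition) × Finset ℕ)) := by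
  ext ⟨p, O⟩
  simp only [coe_sigma, Set.mem_sigma_iff, mem_coe, mem_univ, true_and, mem_filter, mem_powerset]
  constructor
  · rintro ⟨π, hπ, h⟩
    simp only [Overpartition.toSigma, Sigma.mk.injEq, heq_eq_eq] at h
    obtain ⟨rfl, rfl⟩ := h
    exact ⟨π.overlined_subset, π.mem_avoiding_iff.mp hπ⟩
  · rintro ⟨hO, h⟩
    exact ⟨⟨p, O, hO⟩, (Overpartition.mem_avoiding_iff _).mpr h, rfl⟩

lemma overpartitionsAvoiding_finite (k n : ℕ) : (overpartitionsAvoiding k n).Finite := by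
  classical
  refine Set.Finite.of_finite_image ?_ (Overpartition.toSigma_injective n).injOn
  rw [image_overpartitionsAvoiding]
  exact finite_toSet _

/-- Expanding the product of the two summands of `overlineCount` over the part sizes sums over all
sets of overlined part sizes. -/
lemma ncard_overpartitionsAvoiding (k n : ℕ) :
    ((overpartitionsAvoiding k n).ncard : ℤ) =
      PowerSeries.coeff n (Nat.Partition.genFun (overlineCount k)) := by
  classical
  rw [← Set.ncard_image_of_injective _ (Overpartition.toSigma_injective n),
    image_overpartitionsAvoiding, Set.ncard_coe_finset, card_sigma, Nat.Partition.coeff_genFun]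
  push_cast
  refine sum_congr rfl fun p _ => ?_
  have hcount : p.parts.toFinsupp.prod (overlineCount k) = ∏ i ∈ p.parts.toFinset,
      ((if IsExcludedPart k i ∧ p.parts.count i ≠ 1 then 0 else 1) +
        (if IsExcludedPart k i then 0 else 1)) := by
    rw [Finsupp.prod, Multiset.toFinsupp_support]
    refine prod_congr rfl fun i _ => ?_
    rw [Multiset.toFinsupp_apply, overlineCount]
  rw [hcount, prod_add, ← sum_boole]
  refine sum_congr rfl fun O _ => ?_
  have hprod : ∀ (t : Finset ℕ) (c : ℕ → Prop) [DecidablePred c],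
      (∏ i ∈ t, if c i then (0 : ℤ) else 1) = if ∀ i ∈ t, ¬ c i then 1 else 0 := by
    intro t c _
    split_ifs with h
    · exact prod_eq_one fun i hi => if_neg (h i hi)
    · push Not at h
      obtain ⟨i, hi, hc⟩ := h
      exact prod_eq_zero hi (if_pos hc)
  rw [hprod, hprod, ite_and]
  split_ifs <;> simp

open Classical in
/-- The factor of a part size: `(1 + X^p) / (1 - X^p)` if it is unrestricted and `1 + X^p` if it is
excluded as a non-overlined part. -/
lemma genFun_factor (k i : ℕ) :
    (1 + ∑' j, overlineCount k (i + 1) (j + 1) • (PowerSeries.X : ℤ⟦X⟧) ^ ((i + 1) * (j + 1))) *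
      (1 - PowerSeries.X ^ (i + 1)) = (1 + PowerSeries.X ^ (i + 1)) *
        if IsExcludedPart k (i + 1) then 1 - PowerSeries.X ^ (i + 1) else 1 := by
  by_cases h : IsExcludedPart k (i + 1)
  · have hsum : ∑' j, overlineCount k (i + 1) (j + 1) •
        (PowerSeries.X : ℤ⟦X⟧) ^ ((i + 1) * (j + 1)) = PowerSeries.X ^ (i + 1) := by
      rw [tsum_eq_single 0]
      · simp [overlineCount, h]
      · intro j hj
        simp [overlineCount, h, hj]
    rw [hsum, if_pos h]
  · have hc : PowerSeries.constantCoeff ((PowerSeries.X : ℤ⟦X⟧) ^ (i + 1)) = 0 := by simp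
    have hg := PowerSeries.WithPiTopology.tsum_pow_mul_one_sub_of_constantCoeff_eq_zero hc
    have hs := PowerSeries.WithPiTopology.summable_pow_of_constantCoeff_eq_zero hc
    have hsum : ∑' j, overlineCount k (i + 1) (j + 1) •
        (PowerSeries.X : ℤ⟦X⟧) ^ ((i + 1) * (j + 1)) =
        2 * (PowerSeries.X ^ (i + 1) * ∑' j : ℕ, ((PowerSeries.X : ℤ⟦X⟧) ^ (i + 1)) ^ j) := by
      rw [← hs.tsum_mul_left, ← (hs.mul_left _).tsum_mul_left]
      refine tsum_congr fun j => ?_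
      simp only [overlineCount, h, false_and, if_false]
      rw [pow_mul, pow_succ']
      simp [two_mul]
    rw [hsum, if_neg h]
    linear_combination (2 * PowerSeries.X ^ (i + 1)) * hg

open Classical in
/-- As `k = d + 3 ≥ 3`, the residues `1`, `k - 1` and `k` are distinct and each block of `k`
consecutive part sizes contributes one factor to each of the three products. -/
lemma prod_excluded (d M : ℕ) :
    ∏ i ∈ range ((d + 3) * M),
      (if IsExcludedPart (d + 3) (i + 1) then 1 - (PowerSeries.X : ℤ⟦X⟧) ^ (i + 1) else 1) =
    qPoch PowerSeries.X (PowerSeries.X ^ (d + 3)) M *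
      qPoch (PowerSeries.X ^ (d + 2)) (PowerSeries.X ^ (d + 3)) M *
      qPoch (PowerSeries.X ^ (d + 3)) (PowerSeries.X ^ (d + 3)) M := by
  induction M with
  | zero => simp
  | succ M ih =>
    rw [mul_add, mul_one, prod_range_add, ih, qPoch_succ, qPoch_succ, qPoch_succ]
    have h : ∏ r ∈ range (d + 3), (if IsExcludedPart (d + 3) ((d + 3) * M + r + 1) then
        1 - (PowerSeries.X : ℤ⟦X⟧) ^ ((d + 3) * M + r + 1) else 1) =
        (1 - PowerSeries.X ^ ((d + 3) * M + 1)) * (1 - PowerSeries.X ^ ((d + 3) * M + (d + 2))) *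
          (1 - PowerSeries.X ^ ((d + 3) * M + (d + 3))) := by
      rw [prod_range_succ, prod_range_succ, prod_range_succ']
      have h0 : IsExcludedPart (d + 3) ((d + 3) * M + 0 + 1) :=
        (isExcludedPart_iff (d := d) (M := M) (r := 0) (by omega)).mpr (by omega)
      have h1 : IsExcludedPart (d + 3) ((d + 3) * M + (d + 1) + 1) :=
        (isExcludedPart_iff (by omega)).mpr (by omega)
      have h2 : IsExcludedPart (d + 3) ((d + 3) * M + (d + 2) + 1) :=
        (isExcludedPart_iff (by omega)).mpr (by omega)
      have h3 : ∀ r ∈ range d, ¬ IsExcludedPart (d + 3) ((d + 3) * M + (r + 1) + 1) := by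
        intro r hr
        have := mem_range.mp hr
        rw [isExcludedPart_iff (by omega)]
        omega
      rw [prod_eq_one fun r hr => if_neg (h3 r hr), if_pos h0, if_pos h1, if_pos h2]
      ring
    rw [h]
    ring

/-- The generating function of the overpartitions whose non-overlined parts are not congruent to
`0`, `1`, `-1` modulo `k = d + 3`, as an infinite product. -/
lemma genFun_overlineCount (d : ℕ) :
    Nat.Partition.genFun (overlineCount (d + 3)) =
      qPochInf (-PowerSeries.X) PowerSeries.X *
        PowerSeries.invOfUnit (qPochInf PowerSeries.X PowerSeries.X) 1 *
        (qPochInf PowerSeries.X (PowerSeries.X ^ (d + 3)) *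
          qPochInf (PowerSeries.X ^ (d + 2)) (PowerSeries.X ^ (d + 3)) *
          qPochInf (PowerSeries.X ^ (d + 3)) (PowerSeries.X ^ (d + 3))) := by
  classical
  have hX0 : PowerSeries.constantCoeff (PowerSeries.X : ℤ⟦X⟧) = 0 := by simp
  have hX3 : PowerSeries.constantCoeff ((PowerSeries.X : ℤ⟦X⟧) ^ (d + 3)) = 0 := by simp
  have hsub : Tendsto (fun M => (d + 3) * M) atTop atTop :=
    tendsto_id.const_mul_atTop' (by omega)
  have h1 := (((Nat.Partition.hasProd_genFun (overlineCount (d + 3))).tendsto_prod_nat.mul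
    (tendsto_qPoch PowerSeries.X _ hX0)).comp hsub)
  have h2 := ((tendsto_qPoch (-PowerSeries.X) _ hX0).comp hsub).mul
    (((tendsto_qPoch PowerSeries.X _ hX3).mul (tendsto_qPoch (PowerSeries.X ^ (d + 2)) _ hX3)).mul
      (tendsto_qPoch (PowerSeries.X ^ (d + 3)) _ hX3))
  have h3 : Nat.Partition.genFun (overlineCount (d + 3)) *
      qPochInf PowerSeries.X PowerSeries.X = _ :=
    tendsto_nhds_unique h1 (h2.congr fun M => by
      simp only [Function.comp_apply]
      rw [← prod_excluded]
      simp only [qPoch]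
      rw [← prod_mul_distrib, ← prod_mul_distrib]
      refine prod_congr rfl fun i _ => ?_
      have h := genFun_factor (d + 3) i
      rw [show (-PowerSeries.X * PowerSeries.X ^ i : ℤ⟦X⟧) = -PowerSeries.X ^ (i + 1) by ring,
        show (PowerSeries.X * PowerSeries.X ^ i : ℤ⟦X⟧) = PowerSeries.X ^ (i + 1) by ring,
        sub_neg_eq_add]
      exact h.symm)
  linear_combination PowerSeries.invOfUnit (qPochInf PowerSeries.X PowerSeries.X) 1 * h3 -
    Nat.Partition.genFun (overlineCount (d + 3)) * qPochInf_mul_invOfUnit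

theorem theorem1p1 (k : ℕ) (hk : 3 ≤ k) :
    HasSum
      (fun l : {l : ℕ →₀ ℕ // IsAntiLectureHall l ∧ l 0 ≤ k - 2} =>
        (PowerSeries.X : ℤ⟦X⟧) ^ weight l.1)
      (qPochInf (-PowerSeries.X) PowerSeries.X *
        PowerSeries.invOfUnit (qPochInf PowerSeries.X PowerSeries.X) 1 *
        (qPochInf PowerSeries.X (PowerSeries.X ^ k) *
          qPochInf (PowerSeries.X ^ (k - 1)) (PowerSeries.X ^ k) *
          qPochInf (PowerSeries.X ^ k) (PowerSeries.X ^ k))) ∧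
    ∀ n : ℕ, 0 < n →
      (antiLectureHallBounded (k - 2) n).Finite ∧ (overpartitionsAvoiding k n).Finite ∧
      (antiLectureHallBounded (k - 2) n).ncard = (overpartitionsAvoiding k n).ncard := by
  obtain ⟨d, rfl⟩ : ∃ d, k = d + 3 := ⟨k - 3, by omega⟩
  rw [show d + 3 - 2 = d + 1 by omega, show d + 3 - 1 = d + 2 by omega]
  have hlim := tendsto_iff_eventually_coeff_eq.mp
    (tendsto_of_recursion (alhGF_zero_left PowerSeries.X) (alhGF_succ_left PowerSeries.X) (d + 1))
  have hcoeff : ∀ n, _ = ((antiLectureHallBounded (d + 1) n).ncard : ℤ) := fun n => by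
    obtain ⟨L, hL, hn⟩ := ((hlim n).and (eventually_ge_atTop n)).exists
    exact hL.symm.trans (coeff_alhGF hn)
  refine ⟨hasSum_X_pow_weight hcoeff, fun n _ => ⟨antiLectureHallBounded_finite _ _,
    overpartitionsAvoiding_finite _ _, ?_⟩⟩
  have h := (hcoeff n).symm
  rw [show d + 1 + 2 = d + 3 by ring, show d + 1 + 1 = d + 2 by ring, ← genFun_overlineCount,
    ← ncard_overpartitionsAvoiding] at h
  exact_mod_cast h
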